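/- Let $\mathcal L$ be a countable first order language and let $T$ be an $\omega$-categorical $\mathcal L$-theory, i.e. any two models of $T$ of cardinality $\aleph_0$ are isomorphic. For an $\mathcal L$-structure $M$, let $W(M)$ be the weak monadic second order structure of $M$: its universe is the set of all finite subsets of $M$, and it carries the inclusion relation $\subseteq$ together with, for every $n$ and every $\mathcal L$-formula $\varphi(x_1,\dots,x_n)$ without parameters, the $n$-ary relation $\{(\{x_1\},\dots,\{x_n\}) : M\models\varphi(x_1,\dots,x_n)\}$. Here, and below, $x\in M$ is identified with the atom $\{x\}$ of $W(M)$, so that subsets of $M^n$ are regarded as subsets of $W(M)^n$. (i) If $M \prec N$ are models of $T$, then $W(M)\prec W(N)$. (More generally, if $f: M\to N$ is an elementary embedding between models of $T$, then $A\mapsto f[A]$ is an elementary embedding $W(M)\to W(N)$.) (ii) Let $M\models T$. Then $M$ is stably embedded in $W(M)$: the set $M$ is definable in $W(M)$ without parameters, and every subset of $M^n$ that is definable in $W(M)$ with parameters from $W(M)$ is definable in $W(M)$ with parameters from $M$. More precisely, for all $n,k\ge 0$, every $S\subseteq M^n$ that is definable in $W(M)$ with parameters $a_1,\dots,a_k\in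 W(M)$ is definable in the $\mathcal L$-structure $M$ with parameters from the finite set $a_1\cup\dots\cup a_k$. -/

import Mathlib

open FirstOrder Cardinal

universe u v w w₁ w₂

namespace FirstOrder.Language

/-- Relation symbols for weak monadic second order structures of `L`-structures: a binary symbol for
inclusion, and an `n`-ary symbol for every `L`-formula in `n` free variables (without parameters),
naming the subset of `M^n` that the formula defines. -/
inductive WeakMonadicRel (L : Language.{u, v}) : ℕ → Type (max u v)
  | subset : WeakMonadicRel L 2
  | definable {n : ℕ} (φ : L.Formula (Fin n)) : WeakMonadicRel L n

/-- The (relational) language of the structures `W(M)`, for `M` an `L`-structure. Its relation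
symbols are indexed by formulas, so that it is the same language for all `L`-structures. -/
def weakMonadic (L : Language.{u, v}) : Language.{0, max u v} where
  Functions := fun _ => Empty
  Relations := WeakMonadicRel L

/-- The tuple of atoms `({x_1}, …, {x_n})` of the poset of finite subsets of `M` which is identified
with the tuple `(x_1, …, x_n)` of elements of `M`. -/
def atomTuple {M : Type w} {n : ℕ} (x : Fin n → M) : Fin n → Finset M :=
  fun i => {x i}

/-- The weak monadic second order structure `W(M)`. Its universe is the set `Finset M` of finite
subsets of `M`; it carries inclusion, and all the subsets of `M^n` that are definable in `M` without
parameters, where `M` is identified with the set of atoms (singletons). -/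
instance weakMonadicStructure (L : Language.{u, v}) (M : Type w) [L.Structure M] :
    L.weakMonadic.Structure (Finset M) where
  funMap := fun f => Empty.elim f
  RelMap := fun {_} R =>
    match R with
    | WeakMonadicRel.subset => fun A => A 0 ⊆ A 1
    | WeakMonadicRel.definable φ => fun A => A ∈ atomTuple '' {x | φ.Realize x}

/-- A subset `D` of an `L`-structure `K` is stably embedded in `K` if it is definable without
parameters and every subset of `D^n` that is definable in `K` with parameters from `K` is definable
in `K` with parameters from `D`. -/
def StablyEmbedded (L : Language.{u, v}) {K : Type w} [L.Structure K] (D : Set K) : Prop :=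
  (∅ : Set K).Definable₁ L D ∧
    ∀ (n : ℕ) (S : Set (Fin n → K)), (∀ x ∈ S, ∀ i, x i ∈ D) →
      (Set.univ : Set K).Definable L S → D.Definable L S

end FirstOrder.Language

/-! By Ryll-Nardzewski, a model `M` of `T` has finitely many types in each finite set of variables,
all isolated (`hasFinitelyManyTypes_of_categorical`). Hence tuples of equal type in elementarily
equivalent models stay of equal type under suitable finite extensions (`SameType.exists_extension`).
A finite subset is a set of entries of a finite tuple, so a quantifier over finite subsets amounts
to such an extension. Induction on formulas then shows that truth in `W(M)` depends only on the type
of a tuple covering the sets involved and on the index sets that name them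
(`SameType.weakMonadic_realize_iff`).

Part (i) compares a tuple with its image under `f`. Part (ii) compares `M` with itself: a set
definable from `a_1, …, a_k` is invariant under equality of types over the union of the `a_i`, so it
is a finite union of sets defined by isolating formulas.

For Ryll-Nardzewski, compactness and categoricity show that a countably infinite model realizes
every type. It then contains an atomic elementary submodel, to which it is isomorphic, so all its
types are isolated; infinitely many of them would leave room for a non-isolated one. -/

namespace FirstOrder.Language

variable {L : Language.{u, v}}

/-! ### Isolated types and their transfer along elementary equivalence -/

/-- A formula is isolating in `M` if it decides every other formula in the same variables. -/
def IsIsolating (M : Type w) [L.Structure M] {α : Type} (ψ : L.Formula α) : Prop :=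
  ∀ χ : L.Formula α, (∀ x : α → M, ψ.Realize x → χ.Realize x) ∨
    (∀ x : α → M, ψ.Realize x → ¬ χ.Realize x)

/-- A tuple is atomic if its type is isolated by some formula. -/
def IsAtomicTuple (L : Language.{u, v}) {M : Type w} [L.Structure M] {α : Type} (x : α → M) : Prop :=
  ∃ ψ : L.Formula α, ψ.Realize x ∧ IsIsolating M ψ

/-- Two tuples, possibly in different structures, have the same type. -/
def SameType (L : Language.{u, v}) {M : Type w₁} {N : Type w₂} [L.Structure M] [L.Structure N]
    {α : Type} (x : α → M) (y : α → N) : Prop :=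
  ∀ φ : L.Formula α, φ.Realize x ↔ φ.Realize y

/-- In every finite set of variables, `M` has finitely many types, all of them isolated. -/
def HasFinitelyManyTypes (L : Language.{u, v}) (M : Type w) [L.Structure M] : Prop :=
  ∀ (γ : Type) [Finite γ], ∃ Δ : Finset (L.Formula γ),
    (∀ x : γ → M, ∃ ψ ∈ Δ, ψ.Realize x) ∧ ∀ ψ ∈ Δ, IsIsolating M ψ

section Isolating

variable {M : Type w} [L.Structure M] {α β : Type}

theorem IsIsolating.imp {ψ χ : L.Formula α} (h : IsIsolating M ψ) {x y : α → M}
    (hx : ψ.Realize x) (hy : ψ.Realize y) (hχ : χ.Realize x) : χ.Realize y :=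
  (h χ).elim (fun h => h y hy) (fun h => absurd hχ (h x hx))

/-- A formula `χ` about `z ∘ σ` is the formula `χ.relabel σ` about `z`, which `ψ` already decides.
-/
theorem IsAtomicTuple.comp [Finite α] [Finite β] {x : α → M} (h : IsAtomicTuple L x)
    (σ : β → α) : IsAtomicTuple L (x ∘ σ) := by
  obtain ⟨ψ, hx, hψ⟩ := h
  let θ : L.Formula β := Formula.iExs α (ψ.relabel Sum.inr ⊓
    Formula.iInf fun b : β => Term.equal (Term.var (Sum.inl b)) (Term.var (Sum.inr (σ b))))
  have hθ : ∀ y : β → M, θ.Realize y ↔ ∃ z : α → M, ψ.Realize z ∧ y = z ∘ σ := by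
    intro y
    simp only [θ, Formula.realize_iExs, Formula.realize_inf, Formula.realize_relabel,
      Sum.elim_comp_inr, Formula.realize_iInf, Formula.realize_equal, Term.realize_var,
      Sum.elim_inl, Sum.elim_inr, funext_iff, Function.comp_apply]
  refine ⟨θ, (hθ _).2 ⟨x, hx, rfl⟩, fun χ => ?_⟩
  refine (hψ (χ.relabel σ)).imp (fun h y hy => ?_) (fun h y hy => ?_) <;>
  · obtain ⟨z, hz, rfl⟩ := (hθ y).1 hy
    simpa using h z hz

end Isolating

section Transfer

variable {M : Type w₁} {N : Type w₂} [L.Structure M] [L.Structure N] {α β : Type}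

theorem ElementarilyEquivalent.forall_realize_iff [Finite α] (h : M ≅[L] N) (φ : L.Formula α) :
    (∀ x : α → M, φ.Realize x) ↔ ∀ x : α → N, φ.Realize x := by
  have := h.realize_sentence (Formula.iAlls α (φ.relabel (Sum.inr : α → Empty ⊕ α)))
  simpa [Sentence.Realize, Formula.realize_iAlls, Formula.realize_relabel, Function.comp_def]
    using this

theorem IsIsolating.transfer [Finite α] (h : M ≅[L] N) {ψ : L.Formula α}
    (hψ : IsIsolating M ψ) : IsIsolating N ψ := fun χ =>
  (hψ χ).imp
    (fun H => by simpa using (h.forall_realize_iff (ψ.imp χ)).1 (by simpa using H))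
    (fun H => by simpa using (h.forall_realize_iff (ψ.imp χ.not)).1 (by simpa using H))

/-- Since `Δ` is finite, its disjunction is a formula, and the covering property is a single
sentence. -/
theorem HasFinitelyManyTypes.transfer (h : M ≅[L] N) (hM : HasFinitelyManyTypes L M) :
    HasFinitelyManyTypes L N := by
  intro γ _
  obtain ⟨Δ, hcov, hiso⟩ := hM γ
  refine ⟨Δ, ?_, fun ψ hψ => (hiso ψ hψ).transfer h⟩
  have := (h.forall_realize_iff (Formula.iSup fun ψ : Δ => (ψ : L.Formula γ))).1
    (by simpa using hcov)
  simpa using this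

theorem SameType.symm {x : α → M} {y : α → N} (h : SameType L x y) : SameType L y x :=
  fun φ => (h φ).symm

/-- If `ψ` isolates the type of `(x, x')`, then `∃ x', ψ` belongs to the common type of `x` and `y`.
Any witness over `y` works, because each implication `ψ → χ` valid in `M` is valid in `N`. -/
theorem SameType.exists_extension [Finite α] [Finite β] (hM : HasFinitelyManyTypes L M)
    (hMN : M ≅[L] N) {x : α → M} {y : α → N} (h : SameType L x y) (x' : β → M) :
    ∃ y' : β → N, SameType L (Sum.elim x x') (Sum.elim y y') := by
  obtain ⟨Δ, hcov, hiso⟩ := hM (α ⊕ β)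
  obtain ⟨ψ, hψΔ, hψ⟩ := hcov (Sum.elim x x')
  have hy : (Formula.iExs β ψ).Realize y :=
    (h _).1 (Formula.realize_iExs.2 ⟨x', hψ⟩)
  obtain ⟨y', hy'⟩ := Formula.realize_iExs.1 hy
  have key : ∀ χ : L.Formula (α ⊕ β), χ.Realize (Sum.elim x x') → χ.Realize (Sum.elim y y') := by
    intro χ hχ
    have H : ∀ z : α ⊕ β → M, (ψ.imp χ).Realize z := fun z => by
      simpa using fun hz => (hiso ψ hψΔ).imp hψ hz hχ
    have := (hMN.forall_realize_iff (ψ.imp χ)).1 H (Sum.elim y y')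
    exact Formula.realize_imp.1 this hy'
  refine ⟨y', fun χ => ⟨key χ, fun hχ => ?_⟩⟩
  by_contra hc
  exact (Formula.realize_not.1 (key χ.not (Formula.realize_not.2 hc))) hχ

end Transfer

/-! ### The Ryll-Nardzewski theorem -/

theorem hasFinitelyManyTypes_of_finite (M : Type w) [L.Structure M] [Finite M] :
    HasFinitelyManyTypes L M := by
  classical
  intro γ _
  have key : ∀ x : γ → M, IsAtomicTuple L x := by
    intro x
    -- The finite conjunction of these `χ`, one for each tuple `y`, isolates the type of `x`.
    have : ∀ y : γ → M, ∃ χ : L.Formula γ, χ.Realize x ∧ (χ.Realize y → SameType L x y) := by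
      intro y
      by_contra! hc
      have h1 : ∀ χ : L.Formula γ, χ.Realize x → χ.Realize y := fun χ hχ => (hc χ hχ).1
      refine (hc ⊤ (by simp)).2 fun χ => ⟨h1 χ, fun hχ => ?_⟩
      by_contra hn
      exact Formula.realize_not.1 (h1 χ.not (Formula.realize_not.2 hn)) hχ
    choose χ hχ hχ' using this
    refine ⟨Formula.iInf χ, by simpa using hχ, fun φ => ?_⟩
    have H : ∀ y, (Formula.iInf χ).Realize y → SameType L x y := fun y hy =>
      hχ' y (Formula.realize_iInf.1 hy y)
    by_cases hφ : φ.Realize x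
    · exact Or.inl fun y hy => (H y hy φ).1 hφ
    · exact Or.inr fun y hy hc => hφ ((H y hy φ).2 hc)
  choose ψ hψ hiso using key
  have := Fintype.ofFinite (γ → M)
  refine ⟨Finset.univ.image ψ, fun x => ⟨ψ x, by simp, hψ x⟩, ?_⟩
  intro φ hφ
  obtain ⟨x, -, rfl⟩ := Finset.mem_image.1 hφ
  exact hiso x

/-- Every finitely satisfiable set of formulas is realized in `K`. -/
def RealizesTypes (L : Language.{u, v}) (K : Type w) [L.Structure K] : Prop :=
  ∀ (γ : Type) [Finite γ] (Γ : Set (L.Formula γ)),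
    (∀ Δ : Finset (L.Formula γ), ↑Δ ⊆ Γ → ∃ x : γ → K, ∀ φ ∈ Δ, φ.Realize x) →
      ∃ x : γ → K, ∀ φ ∈ Γ, φ.Realize x

theorem equiv_of_categorical {T : L.Theory} (hT : (ℵ₀ : Cardinal.{w}).Categorical T) {K : Type w} [L.Structure K] (hK : K ⊨ T) [Countable K] [Infinite K]
    {K' : Type w} [L.Structure K'] (hK' : K' ⊨ T) [Countable K'] [Infinite K'] :
    Nonempty (K ≃[L] K') :=
  hT (Theory.ModelType.of T K) (Theory.ModelType.of T K') (mk_eq_aleph0 K) (mk_eq_aleph0 K')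

/-- By compactness, `Γ` together with the complete theory of `K` has a countably infinite model,
with new constants realizing `Γ`. Its `L`-reduct is isomorphic to `K`, which carries the realization
over. -/
theorem realizesTypes_of_categorical [Countable L.Symbols] {T : L.Theory}
    (hT : (ℵ₀ : Cardinal.{w}).Categorical T) (K : Type w) [L.Structure K] (hK : K ⊨ T) [Countable K] [Infinite K] :
    RealizesTypes L K := by
  classical
  intro γ _ Γ hΓ
  let T₁ : L[[γ]].Theory := (L.lhomWithConstants γ).onTheory (L.completeTheory K) ∪
    Formula.equivSentence '' Γ
  have hsat : T₁.IsSatisfiable := by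
    rw [Theory.isSatisfiable_iff_isFinitelySatisfiable]
    intro T₀ hT₀
    let Δ : Finset (L.Formula γ) :=
      (T₀.image Formula.equivSentence.symm).filter (· ∈ Γ)
    obtain ⟨x, hx⟩ := hΓ Δ (fun φ hφ => (Finset.mem_filter.1 hφ).2)
    let := constantsOn.structure x
    have hmod : K ⊨ (T₀ : L[[γ]].Theory) := by
      refine ⟨fun φ hφ => ?_⟩
      rcases hT₀ hφ with h | ⟨χ, hχ, rfl⟩
      · obtain ⟨χ, hχ, rfl⟩ := h
        exact (LHom.realize_onSentence K _ χ).2 hχ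
      · rw [Formula.realize_equivSentence]
        exact hx χ (Finset.mem_filter.2 ⟨Finset.mem_image.2 ⟨_, hφ, by simp⟩, hχ⟩)
    exact Theory.Model.isSatisfiable K
  obtain ⟨N₀⟩ := hsat
  have hinf : Infinite N₀ := by
    have hN₀ : N₀ ⊨ (L.lhomWithConstants γ).onTheory (L.completeTheory K) :=
      N₀.is_model.mono Set.subset_union_left
    let : L.Structure N₀ := (L.lhomWithConstants γ).reduct N₀
    have h2 : N₀ ⊨ L.completeTheory K := (LHom.onTheory_model _ _).1 hN₀
    have h3 : N₀ ≅[L] K := (elementarilyEquivalent_iff.2 fun φ =>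
      (realize_iff_of_model_completeTheory K N₀ φ))
    exact h3.symm.infinite
  obtain ⟨N, hN⟩ := Theory.exists_model_card_eq (T := T₁) ⟨N₀, hinf⟩ (ℵ₀ : Cardinal.{w}) le_rfl
    (by
      have : L[[γ]].card ≤ ℵ₀ := mk_le_aleph0 (α := L[[γ]].Symbols)
      simpa using this)
  have hNK : N ⊨ (L.lhomWithConstants γ).onTheory (L.completeTheory K) :=
    N.is_model.mono Set.subset_union_left
  let : L.Structure N := (L.lhomWithConstants γ).reduct N
  have h2 : N ⊨ L.completeTheory K := (LHom.onTheory_model _ _).1 hNK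
  have h3 : N ≅[L] K := (elementarilyEquivalent_iff.2 fun φ =>
      (realize_iff_of_model_completeTheory K N φ))
  have hNT : N ⊨ T := h3.theory_model_iff.2 hK
  have : Countable N := mk_le_aleph0_iff.1 hN.le
  have : Infinite N := infinite_iff.2 hN.ge
  obtain ⟨e⟩ := equiv_of_categorical hT hNT hK
  refine ⟨fun a => e (L.con a : N), fun φ hφ => ?_⟩
  have h4 : N ⊨ Formula.equivSentence φ :=
    N.is_model.realize_of_mem _ (Or.inr ⟨φ, hφ, rfl⟩)
  rw [Formula.realize_equivSentence] at h4
  exact (StrongHomClass.realize_formula e φ).2 h4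

/-- Isolating formulas are dense in a countable structure that realizes all types: a failure yields
a decreasing sequence of satisfiable formulas, the `i`-th of which avoids the `i`-th tuple. -/
theorem RealizesTypes.exists_isIsolating {K : Type w} [L.Structure K] [Countable K]
    (hK : RealizesTypes L K) {α : Type} [Finite α] (φ : L.Formula α) (x : α → K)
    (hx : φ.Realize x) :
    ∃ ψ : L.Formula α, (∃ y : α → K, ψ.Realize y) ∧ (∀ y : α → K, ψ.Realize y → φ.Realize y) ∧
      IsIsolating K ψ := by
  by_contra! hc
  have : Countable (α → K) := inferInstance
  have : Nonempty (α → K) := ⟨x⟩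
  obtain ⟨e, he⟩ := exists_surjective_nat (α → K)
  let P := {ψ : L.Formula α // (∃ y : α → K, ψ.Realize y) ∧
    ∀ y : α → K, ψ.Realize y → φ.Realize y}
  have step : ∀ (ψ : P) (z : α → K), ∃ θ : P,
      (∀ y : α → K, θ.1.Realize y → ψ.1.Realize y) ∧ ¬ θ.1.Realize z := by
    rintro ⟨ψ, hs, hi⟩ z
    have h := hc ψ hs hi
    simp only [IsIsolating, not_forall, not_or, not_not] at h
    obtain ⟨χ, ⟨y₁, hy₁, hn₁⟩, ⟨y₂, hy₂, hn₂⟩⟩ := h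
    by_cases hz : χ.Realize z
    · exact ⟨⟨ψ ⊓ χ.not, ⟨y₁, by simp [hy₁, hn₁]⟩, fun y hy => hi y (Formula.realize_inf.1 hy).1⟩,
        fun y hy => (Formula.realize_inf.1 hy).1, by simp [hz]⟩
    · exact ⟨⟨ψ ⊓ χ, ⟨y₂, by simp [hy₂, hn₂]⟩, fun y hy => hi y (Formula.realize_inf.1 hy).1⟩,
        fun y hy => (Formula.realize_inf.1 hy).1, by simp [hz]⟩
  choose next hnext hnext' using step
  let s : ℕ → P := fun n => Nat.rec ⟨φ, ⟨x, hx⟩, fun _ h => h⟩ (fun i ψ => next ψ (e i)) n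
  have hanti : ∀ i j, i ≤ j → ∀ y : α → K, (s j).1.Realize y → (s i).1.Realize y := by
    intro i j hij
    induction hij with
    | refl => exact fun y h => h
    | step _ ih => exact fun y h => ih y (hnext _ _ y h)
  obtain ⟨y, hy⟩ := hK α (Set.range fun i => (s i).1) (by
    intro Δ hΔ
    have : ∀ ψ : Δ, ∃ i, (s i).1 = ψ.1 := fun ψ => hΔ ψ.2
    choose idx hidx using this
    obtain ⟨y, hy⟩ := (s (Finset.univ.sup idx)).2.1
    refine ⟨y, fun ψ hψ => ?_⟩
    refine (congrArg (fun θ : L.Formula α => θ.Realize y) (hidx ⟨ψ, hψ⟩)).mp ?_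
    exact hanti _ _ (Finset.le_sup (Finset.mem_univ _)) y hy)
  obtain ⟨i, rfl⟩ := he y
  exact hnext' (s i) (e i) (hy _ ⟨i + 1, rfl⟩)

/-- An isolating `θ` below `ψ ∧ φ` may be realized over another tuple than `x`; since `ψ` isolates
the type of `x`, the formula `∃ x', θ` holds at `x` too. -/
theorem RealizesTypes.exists_atomic_extension {K : Type w} [L.Structure K] [Countable K]
    (hK : RealizesTypes L K) {α β : Type} [Finite α] [Finite β] {x : α → K}
    (hx : IsAtomicTuple L x) (φ : L.Formula (α ⊕ β)) {x' : β → K}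
    (hφ : φ.Realize (Sum.elim x x')) :
    ∃ y : β → K, φ.Realize (Sum.elim x y) ∧ IsAtomicTuple L (Sum.elim x y) := by
  obtain ⟨ψ, hψx, hψ⟩ := hx
  obtain ⟨θ, ⟨z, hz⟩, hθ, hiso⟩ := hK.exists_isIsolating (ψ.relabel Sum.inl ⊓ φ) (Sum.elim x x')
    (by simp [hψx, hφ])
  have hz' : (Formula.iExs β θ).Realize (z ∘ Sum.inl) :=
    Formula.realize_iExs.2 ⟨z ∘ Sum.inr, by simpa [Sum.elim_comp_inl_inr] using hz⟩
  have hψz : ψ.Realize (z ∘ Sum.inl) := by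
    simpa using (Formula.realize_inf.1 (hθ z hz)).1
  obtain ⟨y, hy⟩ := Formula.realize_iExs.1 (hψ.imp hψz hψx hz')
  exact ⟨y, (Formula.realize_inf.1 (hθ _ hy)).2, θ, hy, hiso⟩

/-- The enumerations of finite sets that form atomic tuples. -/
structure AtomicEnumeration (L : Language.{u, v}) (K : Type w) [L.Structure K] where
  /-- The length of the tuple. -/
  card : ℕ
  /-- The tuple. -/
  toFun : Fin card → K
  isAtomic : IsAtomicTuple L toFun

instance (K : Type w) [L.Structure K] : Preorder (AtomicEnumeration L K) :=
  Preorder.lift fun A => Set.range A.toFun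

/-- A countable structure realizing all types contains a set that passes the Tarski–Vaught test and
all of whose finite tuples are atomic. -/
theorem RealizesTypes.exists_atomic_set [Countable L.Symbols] {K : Type w} [L.Structure K]
    [Countable K] (hK : RealizesTypes L K) :
    ∃ S : Set K, (∀ (n : ℕ) (x : Fin n → K), (∀ i, x i ∈ S) → IsAtomicTuple L x) ∧
      ∀ (n : ℕ) (φ : L.Formula (Fin n ⊕ Fin 1)) (x : Fin n → K), (∀ i, x i ∈ S) →
        ∀ a : Fin 1 → K, φ.Realize (Sum.elim x a) →
          ∃ b : Fin 1 → K, b 0 ∈ S ∧ φ.Realize (Sum.elim x b) := by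
  classical
  let ι := Σ n, L.Formula (Fin n ⊕ Fin 1) × (Fin n → K)
  have : Nonempty (Encodable ι) := ⟨Encodable.ofCountable ι⟩
  let _ : Encodable ι := Classical.choice this
  -- Each Tarski–Vaught requirement `q` is met only once along the generic sequence, possibly before
  -- its parameters have entered. So `D q` asks for a witness as soon as some extension of `A`
  -- covers the parameters.
  let D : ι → Order.Cofinal (AtomicEnumeration L K) := fun q =>
    { carrier := {A | (∃ a : Fin 1 → K, q.2.1.Realize (Sum.elim q.2.2 a)) →
        (∃ B, A ≤ B ∧ Set.range q.2.2 ⊆ Set.range B.toFun) →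
          ∃ b : Fin 1 → K, b 0 ∈ Set.range A.toFun ∧ q.2.1.Realize (Sum.elim q.2.2 b)}
      isCofinal := by
        obtain ⟨n, φ, x⟩ := q
        intro A
        by_cases h : (∃ a : Fin 1 → K, φ.Realize (Sum.elim x a)) ∧
          ∃ B, A ≤ B ∧ Set.range x ⊆ Set.range B.toFun
        · obtain ⟨⟨a, ha⟩, B, hAB, hxB⟩ := h
          have hσ : ∀ i, ∃ j, B.toFun j = x i := fun i => hxB ⟨i, rfl⟩
          choose σ hσ using hσ
          have hσ' : B.toFun ∘ σ = x := funext hσ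
          obtain ⟨b, hb, hatom⟩ := hK.exists_atomic_extension B.isAtomic
            (φ.relabel (Sum.map σ id)) (x' := a) (by simpa [Sum.elim_comp_map, hσ'] using ha)
          refine ⟨⟨B.card + 1, Sum.elim B.toFun b ∘ finSumFinEquiv.symm,
            hatom.comp finSumFinEquiv.symm⟩, fun _ _ => ⟨b, ?_, ?_⟩, ?_⟩
          · exact ⟨finSumFinEquiv (Sum.inr 0), by simp⟩
          · simpa [Sum.elim_comp_map, hσ'] using hb
          · refine hAB.trans ?_
            rintro _ ⟨j, rfl⟩
            exact ⟨finSumFinEquiv (Sum.inl j), by simp⟩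
        · exact ⟨A, fun h₁ h₂ => absurd ⟨h₁, h₂⟩ h, le_rfl⟩ }
  have hA₀ : IsAtomicTuple L (Fin.elim0 : Fin 0 → K) := by
    obtain ⟨ψ, ⟨y, hy⟩, -, hψ⟩ := hK.exists_isIsolating (⊤ : L.Formula (Fin 0)) Fin.elim0 (by simp)
    exact ⟨ψ, by rwa [Subsingleton.elim Fin.elim0 y], hψ⟩
  let s := Order.sequenceOfCofinals (⟨0, Fin.elim0, hA₀⟩ : AtomicEnumeration L K) D
  have hs : Monotone s := Order.sequenceOfCofinals.monotone _ _
  have hcover : ∀ (n : ℕ) (x : Fin n → K), (∀ i, x i ∈ ⋃ k, Set.range (s k).toFun) →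
      ∃ k, Set.range x ⊆ Set.range (s k).toFun := by
    intro n x hx
    simp only [Set.mem_iUnion] at hx
    choose k hk using hx
    refine ⟨Finset.univ.sup k, ?_⟩
    rintro _ ⟨i, rfl⟩
    exact hs (Finset.le_sup (f := k) (Finset.mem_univ i)) (hk i)
  refine ⟨⋃ k, Set.range (s k).toFun, fun n x hx => ?_, fun n φ x hx a ha => ?_⟩
  · obtain ⟨k, hk⟩ := hcover n x hx
    have hσ : ∀ i, ∃ j, (s k).toFun j = x i := fun i => hk ⟨i, rfl⟩
    choose σ hσ using hσ
    rw [← funext hσ]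
    exact (s k).isAtomic.comp σ
  · obtain ⟨k, hk⟩ := hcover n x hx
    let q : ι := ⟨n, φ, x⟩
    -- The stage after `encode q` lies in `D q`; a later stage containing the parameters is the
    -- extension required there.
    obtain ⟨b, hb, hφ⟩ := Order.sequenceOfCofinals.encode_mem
      (⟨0, Fin.elim0, hA₀⟩ : AtomicEnumeration L K) D q ⟨a, ha⟩
      ⟨s (max k (Encodable.encode q + 1)), hs (le_max_right _ _),
        hk.trans (hs (le_max_left _ _))⟩
    exact ⟨b, Set.mem_iUnion.2 ⟨_, hb⟩, hφ⟩

theorem RealizesTypes.exists_atomic_elementarySubstructure [Countable L.Symbols] {K : Type w}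
    [L.Structure K] [Countable K] (hK : RealizesTypes L K) :
    ∃ S : L.ElementarySubstructure K, ∀ (n : ℕ) (x : Fin n → S),
      IsAtomicTuple L (fun i => (x i : K)) := by
  obtain ⟨S, hatom, htv⟩ := hK.exists_atomic_set
  let S' : L.Substructure K :=
    { carrier := S
      fun_mem := fun {n} f x hx => by
        -- Closure under `f` is the Tarski–Vaught property for the formula `f x = y`.
        obtain ⟨b, hb, hb'⟩ := htv n
          (Term.equal (Term.func f fun i => Term.var (Sum.inl i)) (Term.var (Sum.inr 0))) x hx
          (fun _ => Structure.funMap f x) (by simp [Formula.realize_equal])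
        have : Structure.funMap f x = b 0 := by simpa [Formula.realize_equal] using hb'
        rwa [this] }
  refine ⟨⟨S', S'.isElementary_of_exists ?_⟩, fun n x => hatom n _ fun i => (x i).2⟩
  intro n φ x a ha
  have key : ∀ b : Fin 1 → K, (φ.toFormula.relabel (Sum.elim Empty.elim
      (Fin.snoc (α := fun _ => Fin n ⊕ Fin 1) Sum.inl (Sum.inr 0)))).Realize
        (Sum.elim (fun i => (x i : K)) b) ↔
      φ.Realize default (Fin.snoc ((↑) ∘ x) (b 0) : _ → K) := by
    intro b
    rw [Formula.realize_relabel, BoundedFormula.realize_toFormula]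
    apply iff_of_eq
    congr 1
    · exact Subsingleton.elim _ _
    · ext i
      refine Fin.lastCases ?_ (fun i => ?_) i <;> simp
  obtain ⟨b, hb, hb'⟩ := htv n _ (fun i => (x i : K)) (fun i => (x i).2) (fun _ => a)
    ((key _).2 ha)
  exact ⟨⟨b 0, hb⟩, (key b).1 hb'⟩

theorem hasFinitelyManyTypes_of_countable [Countable L.Symbols] {T : L.Theory}
    (hT : (ℵ₀ : Cardinal.{w}).Categorical T) (K : Type w) [L.Structure K] (hK : K ⊨ T)
    [Countable K] [Infinite K] : HasFinitelyManyTypes L K := by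
  classical
  have hR := realizesTypes_of_categorical hT K hK
  obtain ⟨S, hS⟩ := hR.exists_atomic_elementarySubstructure
  have hSK : S ≅[L] K := S.elementarilyEquivalent
  have : Infinite S := hSK.symm.infinite
  have : Countable S := Subtype.countable
  obtain ⟨e⟩ := equiv_of_categorical hT (hSK.theory_model_iff.2 hK) hK
  have hatom : ∀ (n : ℕ) (x : Fin n → K), IsAtomicTuple L x := by
    intro n x
    obtain ⟨ψ, hψ, hiso⟩ := hS n (e.symm ∘ x)
    refine ⟨ψ, ?_, hiso⟩
    have h₁ : ψ.Realize (e.symm ∘ x) := (S.subtype.map_formula ψ _).1 hψ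
    exact (StrongHomClass.realize_formula e.symm ψ).1 h₁
  intro γ _
  obtain ⟨n, ⟨f⟩⟩ := Finite.exists_equiv_fin γ
  have hatom' : ∀ x : γ → K, IsAtomicTuple L x := fun x => by
    simpa [Function.comp_assoc] using (hatom n (x ∘ f.symm)).comp f
  by_contra! hc
  -- If no finite set of isolating formulas covers all tuples, their negations are finitely
  -- satisfiable, so some tuple satisfies no isolating formula.
  obtain ⟨x, hx⟩ := hR γ {φ | ∃ ψ : L.Formula γ, IsIsolating K ψ ∧ φ = ψ.not} (by
    intro Δ hΔ
    have hΔ' : ∀ φ ∈ Δ, ∃ ψ : L.Formula γ, IsIsolating K ψ ∧ φ = ψ.not := fun φ hφ => hΔ hφ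
    choose! ψ hψ hψ' using hΔ'
    by_contra! hx
    obtain ⟨φ, hφ, hn⟩ := hc (Δ.image ψ) (fun x => by
      obtain ⟨φ, hφ, hφ'⟩ := hx x
      refine ⟨ψ φ, Finset.mem_image_of_mem _ hφ, ?_⟩
      rw [hψ' φ hφ] at hφ'
      simpa using hφ')
    obtain ⟨φ, hφΔ, rfl⟩ := Finset.mem_image.1 hφ
    exact hn (hψ φ hφΔ))
  obtain ⟨ψ, hψ, hiso⟩ := hatom' x
  exact Formula.realize_not.1 (hx _ ⟨ψ, hiso, rfl⟩) hψ

/-- The half of the Ryll-Nardzewski theorem that bounds the number of types. -/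
theorem hasFinitelyManyTypes_of_categorical [Countable L.Symbols] {T : L.Theory}
    (hT : (ℵ₀ : Cardinal.{w}).Categorical T) (M : Type w₁) [L.Structure M] (hM : M ⊨ T) :
    HasFinitelyManyTypes L M := by
  rcases finite_or_infinite M with _ | _
  · exact hasFinitelyManyTypes_of_finite M
  -- Categoricity speaks of countable models in universe `w`, so `M` is replaced by such a model of
  -- its complete theory.
  · obtain ⟨K, hK⟩ := Theory.exists_model_card_eq (T := L.completeTheory M)
      (by
        obtain ⟨N⟩ := Theory.Model.isSatisfiable (T := L.completeTheory M) M
        have h : N ≅[L] M := elementarilyEquivalent_iff.2 fun φ =>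
          realize_iff_of_model_completeTheory M N φ
        exact ⟨N, h.symm.infinite⟩) (ℵ₀ : Cardinal.{w}) le_rfl (by
      have : L.card ≤ ℵ₀ := mk_le_aleph0 (α := L.Symbols)
      simpa using this)
    have h : K ≅[L] M := elementarilyEquivalent_iff.2 fun φ =>
      realize_iff_of_model_completeTheory M K φ
    have : Countable K := mk_le_aleph0_iff.1 hK.le
    have : Infinite K := infinite_iff.2 hK.ge
    exact (hasFinitelyManyTypes_of_countable hT K (h.theory_model_iff.2 hM)).transfer h

/-! ### Back-and-forth between weak monadic structures -/

/-- The finite sets `A` and `B` are the images of the same set of indices under `x` and `y`. -/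
def Corresponds {M : Type w₁} {N : Type w₂} {α : Type} (x : α → M) (y : α → N) (A : Finset M)
    (B : Finset N) : Prop :=
  ∃ I : Set α, (A : Set M) = x '' I ∧ (B : Set N) = y '' I

section Corresponds

variable {M : Type w₁} {N : Type w₂} {α β : Type} {x : α → M} {y : α → N}

theorem Corresponds.symm {A : Finset M} {B : Finset N} (h : Corresponds x y A B) :
    Corresponds y x B A :=
  let ⟨I, hA, hB⟩ := h
  ⟨I, hB, hA⟩

theorem Corresponds.extend {A : Finset M} {B : Finset N} (h : Corresponds x y A B) (x' : β → M)
    (y' : β → N) : Corresponds (Sum.elim x x') (Sum.elim y y') A B := by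
  obtain ⟨I, hA, hB⟩ := h
  exact ⟨Sum.inl '' I, by simp [hA, Set.image_image], by simp [hB, Set.image_image]⟩

theorem corresponds_singleton (i : α) : Corresponds x y {x i} {y i} :=
  ⟨{i}, by simp, by simp⟩

theorem Corresponds.exists_mem_of_eq_singleton {A : Finset M} {B : Finset N}
    (h : Corresponds x y A B) {a : M} (hA : A = {a}) : ∃ i, x i = a := by
  obtain ⟨I, h, -⟩ := h
  have : a ∈ (A : Set M) := by simp [hA]
  rw [h] at this
  obtain ⟨i, -, hi⟩ := this
  exact ⟨i, hi⟩

theorem exists_corresponds_of_subset_range [Finite α] (y : α → N) {A : Finset M}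
    (hA : (A : Set M) ⊆ Set.range x) : ∃ B : Finset N, Corresponds x y A B := by
  refine ⟨(Set.toFinite (y '' (x ⁻¹' A))).toFinset, x ⁻¹' A, ?_, by simp⟩
  rw [Set.image_preimage_eq_inter_range, Set.inter_eq_left.2 hA]

variable [L.Structure M] [L.Structure N]

theorem SameType.eq_iff (h : SameType L x y) (i j : α) : x i = x j ↔ y i = y j := by
  simpa [Formula.realize_equal] using h (Term.equal (Term.var i) (Term.var j))

/-- Tuples may repeat entries, so different index sets can name the same finite set; equality of
types ensures that `x` and `y` have the same repetitions. -/
theorem SameType.subset_of_corresponds (h : SameType L x y) {A A' : Finset M} {B B' : Finset N}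
    (hA : Corresponds x y A B) (hA' : Corresponds x y A' B') (hs : A ⊆ A') : B ⊆ B' := by
  obtain ⟨I, hAI, hBI⟩ := hA
  obtain ⟨J, hAJ, hBJ⟩ := hA'
  rw [← Finset.coe_subset] at hs ⊢
  rw [hAI, hAJ] at hs
  rw [hBI, hBJ]
  rintro _ ⟨i, hi, rfl⟩
  obtain ⟨j, hj, hij⟩ := hs ⟨i, hi, rfl⟩
  exact ⟨j, hj, (h.eq_iff j i).1 hij⟩

theorem SameType.eq_of_corresponds (h : SameType L x y) {A A' : Finset M} {B B' : Finset N}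
    (hA : Corresponds x y A B) (hA' : Corresponds x y A' B') (hs : A = A') : B = B' :=
  (h.subset_of_corresponds hA hA' hs.subset).antisymm (h.subset_of_corresponds hA' hA hs.superset)

theorem SameType.relMap_of_corresponds (h : SameType L x y) {n : ℕ}
    (R : L.weakMonadic.Relations n) {A : Fin n → Finset M} {B : Fin n → Finset N}
    (hAB : ∀ i, Corresponds x y (A i) (B i)) (hR : Structure.RelMap R A) :
    Structure.RelMap R B := by
  rcases R with _ | φ
  · exact h.subset_of_corresponds (hAB 0) (hAB 1) hR
  · obtain ⟨z, hz, rfl⟩ := hR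
    have hσ : ∀ i, ∃ j, x j = z i := fun i => (hAB i).exists_mem_of_eq_singleton rfl
    choose σ hσ using hσ
    refine ⟨y ∘ σ, ?_, ?_⟩
    · have := h (φ.relabel σ)
      rw [Formula.realize_relabel, Formula.realize_relabel, show x ∘ σ = z from funext hσ] at this
      exact this.1 hz
    · funext i
      refine h.eq_of_corresponds (corresponds_singleton (σ i)) (hAB i) ?_
      simp [atomTuple, hσ]

theorem corresponds_term_realize {γ : Type*} (t : L.weakMonadic.Term γ) {v : γ → Finset M}
    {v' : γ → Finset N} (hv : ∀ i, Corresponds x y (v i) (v' i)) :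
    Corresponds x y (t.realize v) (t.realize v') := by
  cases t with
  | var i => exact hv i
  | func f _ => exact f.elim

/-- The back-and-forth argument: corresponding assignments satisfy the same formulas. -/
theorem SameType.weakMonadic_realize_iff (hM : HasFinitelyManyTypes L M)
    (hN : HasFinitelyManyTypes L N) (hMN : M ≅[L] N) {γ : Type*} {n : ℕ}
    (Φ : L.weakMonadic.BoundedFormula γ n) {α : Type} [Finite α] {x : α → M} {y : α → N}
    (h : SameType L x y) {v : γ → Finset M} {v' : γ → Finset N}
    (hv : ∀ i, Corresponds x y (v i) (v' i)) {xs : Fin n → Finset M} {xs' : Fin n → Finset N}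
    (hxs : ∀ i, Corresponds x y (xs i) (xs' i)) : Φ.Realize v xs ↔ Φ.Realize v' xs' := by
  have hsum : ∀ {n : ℕ} {α : Type} {x : α → M} {y : α → N} {v : γ → Finset M}
      {v' : γ → Finset N} {xs : Fin n → Finset M} {xs' : Fin n → Finset N},
      (∀ i, Corresponds x y (v i) (v' i)) → (∀ i, Corresponds x y (xs i) (xs' i)) →
      ∀ i, Corresponds x y (Sum.elim v xs i) (Sum.elim v' xs' i) := by
    intro n α x y v v' xs xs' hv hxs i
    cases i with
    | inl i => exact hv i
    | inr i => exact hxs i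
  -- Every quantifier lengthens the tuples, so their index type must vary.
  induction Φ generalizing α with
  | falsum => exact Iff.rfl
  | equal t₁ t₂ =>
    have h₁ := corresponds_term_realize t₁ (hsum hv hxs)
    have h₂ := corresponds_term_realize t₂ (hsum hv hxs)
    exact ⟨h.eq_of_corresponds h₁ h₂, h.symm.eq_of_corresponds h₁.symm h₂.symm⟩
  | rel R ts =>
    have h₁ := fun i => corresponds_term_realize (ts i) (hsum hv hxs)
    exact ⟨h.relMap_of_corresponds R h₁, h.symm.relMap_of_corresponds R fun i => (h₁ i).symm⟩
  | imp _ _ ih₁ ih₂ =>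
    exact imp_congr (ih₁ h hv hxs) (ih₂ h hv hxs)
  | all Φ ih =>
    have hsnoc : ∀ {n : ℕ} {α : Type} {x : α → M} {y : α → N} {xs : Fin n → Finset M}
        {xs' : Fin n → Finset N} {A : Finset M} {B : Finset N},
        (∀ i, Corresponds x y (xs i) (xs' i)) → Corresponds x y A B →
        ∀ i, Corresponds x y ((Fin.snoc xs A : Fin (n + 1) → Finset M) i)
          ((Fin.snoc xs' B : Fin (n + 1) → Finset N) i) := by
      intro n α x y xs xs' A B hxs hAB i
      refine Fin.lastCases ?_ (fun i => ?_) i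
      · simpa using hAB
      · simpa using hxs i
    rw [BoundedFormula.realize_all, BoundedFormula.realize_all]
    constructor
    · intro H B
      -- Appending an enumeration of `B` to `y` and extending `x` to match yields a finite subset of
      -- `M` corresponding to `B`.
      let e : Fin B.card → N := fun i => B.equivFin.symm i
      have he : (B : Set N) ⊆ Set.range e := fun b hb => ⟨B.equivFin ⟨b, hb⟩, by simp [e]⟩
      obtain ⟨e', h'⟩ := h.symm.exists_extension hN hMN.symm e
      obtain ⟨A, hA⟩ := exists_corresponds_of_subset_range (x := Sum.elim y e) (Sum.elim x e')
        (A := B) (by rw [Set.Sum.elim_range]; exact he.trans Set.subset_union_right)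
      exact (ih h'.symm (fun i => (hv i).extend _ _)
        (hsnoc (fun i => (hxs i).extend _ _) hA.symm)).1 (H A)
    · intro H A
      let e : Fin A.card → M := fun i => A.equivFin.symm i
      have he : (A : Set M) ⊆ Set.range e := fun a ha => ⟨A.equivFin ⟨a, ha⟩, by simp [e]⟩
      obtain ⟨e', h'⟩ := h.exists_extension hM hMN e
      obtain ⟨B, hB⟩ := exists_corresponds_of_subset_range (x := Sum.elim x e) (Sum.elim y e')
        (A := A) (by rw [Set.Sum.elim_range]; exact he.trans Set.subset_union_right)
      exact (ih h' (fun i => (hv i).extend _ _)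
        (hsnoc (fun i => (hxs i).extend _ _) hB)).2 (H B)

end Corresponds

/-! ### Elementary embeddings and definable sets -/

theorem exists_fin_range_eq {M : Type w} {P : Set M} (hP : P.Finite) :
    ∃ (m : ℕ) (p : Fin m → M), Set.range p = P := by
  have := hP.to_subtype
  obtain ⟨m, ⟨e⟩⟩ := Finite.exists_equiv_fin P
  exact ⟨m, fun i => e.symm i, by
    rw [show (fun i => (e.symm i : M)) = Subtype.val ∘ e.symm from rfl, e.symm.surjective.range_comp]
    simp⟩

/-- `A ↦ f[A]` as an elementary embedding of weak monadic second order structures. -/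
theorem exists_weakMonadic_elementaryEmbedding {M : Type w₁} {N : Type w₂} [L.Structure M]
    [L.Structure N] (hM : HasFinitelyManyTypes L M) (f : M ↪ₑ[L] N) :
    ∃ g : Finset M ↪ₑ[L.weakMonadic] Finset N,
      ∀ A : Finset M, (g A : Set N) = f '' (A : Set M) := by
  have hMN : M ≅[L] N := f.elementarilyEquivalent
  refine ⟨⟨fun A => A.map ⟨f, f.injective⟩, fun n Φ A => ?_⟩, fun A => Finset.coe_map _ A⟩
  obtain ⟨m, p, hp⟩ := exists_fin_range_eq (Set.finite_iUnion fun i => (A i).finite_toSet)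
  have hsame : SameType L p (f ∘ p) := fun φ => (f.map_formula φ p).symm
  refine (hsame.weakMonadic_realize_iff hM (hM.transfer hMN) hMN Φ (fun i => ?_)
    (fun i => i.elim0)).symm
  refine ⟨p ⁻¹' (A i), ?_, ?_⟩
  · rw [Set.image_preimage_eq_inter_range, hp,
      Set.inter_eq_left.2 (Set.subset_iUnion (fun i => (A i : Set M)) i)]
  · rw [Set.image_comp, Set.image_preimage_eq_inter_range, hp,
      Set.inter_eq_left.2 (Set.subset_iUnion (fun i => (A i : Set M)) i)]
    simp

/-- Finitely many isolating formulas cover the tuples `(p, z)`. By invariance, `S` is the union of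
the sets defined over `p` by those formulas that some `z ∈ S` satisfies. -/
theorem HasFinitelyManyTypes.definable_of_sameType {M : Type w} [L.Structure M]
    (hM : HasFinitelyManyTypes L M) {β γ : Type} [Finite β] [Finite γ] (p : β → M)
    (S : Set (γ → M))
    (hS : ∀ z z' : γ → M, SameType L (Sum.elim p z) (Sum.elim p z') → z ∈ S → z' ∈ S) :
    (Set.range p).Definable L S := by
  classical
  obtain ⟨Δ, hcov, hiso⟩ := hM (β ⊕ γ)
  let Δ' := Δ.filter fun ψ => ∃ z ∈ S, ψ.Realize (Sum.elim p z)
  have hSΔ : S = ⋃ ψ ∈ Δ', {z | ψ.Realize (Sum.elim p z)} := by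
    ext z
    simp only [Set.mem_iUnion, Set.mem_ofPred_eq, Δ', Finset.mem_filter, exists_prop]
    constructor
    · intro hz
      obtain ⟨ψ, hψ, hψz⟩ := hcov (Sum.elim p z)
      exact ⟨ψ, ⟨hψ, z, hz, hψz⟩, hψz⟩
    · rintro ⟨ψ, ⟨hψ, z', hz', hψz'⟩, hψz⟩
      exact hS z' z (fun χ => ⟨(hiso ψ hψ).imp hψz' hψz, (hiso ψ hψ).imp hψz hψz'⟩) hz'
  rw [hSΔ]
  refine Set.definable_biUnion_finset (fun ψ => ?_) Δ'
  rw [Set.definable_iff_exists_formula_sum]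
  refine ⟨ψ.relabel (Sum.map (Set.rangeFactorization p) id), ?_⟩
  ext z
  simp only [Set.mem_ofPred_eq, Formula.realize_relabel, Sum.elim_comp_map]
  rfl

theorem HasFinitelyManyTypes.definable_of_weakMonadic_definable {M : Type w} [L.Structure M]
    (hM : HasFinitelyManyTypes L M) {n k : ℕ} {S : Set (Fin n → M)} {a : Fin k → Finset M}
    (hS : (Set.range a).Definable L.weakMonadic (atomTuple '' S)) :
    (⋃ i, (a i : Set M)).Definable L S := by
  obtain ⟨m, p, hp⟩ := exists_fin_range_eq (Set.finite_iUnion fun i => (a i).finite_toSet)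
  rw [← hp]
  obtain ⟨Φ, hΦ⟩ := Set.definable_iff_exists_formula_sum.1 hS
  have hinj : Function.Injective (atomTuple : (Fin n → M) → Fin n → Finset M) := fun z z' h =>
    funext fun i => Finset.singleton_injective (congrFun h i)
  have hmem : ∀ z, z ∈ S ↔ Φ.Realize (Sum.elim (↑) (atomTuple z)) := fun z => by
    rw [← hinj.mem_set_image, hΦ]
    rfl
  -- Each `a i` is a set of entries of `p`, so it corresponds to itself when `(p, z)` is compared
  -- with `(p, z')`.
  refine hM.definable_of_sameType p S fun z z' h hz => (hmem z').2 ?_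
  refine (h.weakMonadic_realize_iff hM hM rfl Φ (fun i => ?_) (fun i => i.elim0)).1 ((hmem z).1 hz)
  rcases i with ⟨_, i, rfl⟩ | i
  · refine ⟨Sum.inl '' (p ⁻¹' (a i)), ?_, ?_⟩ <;>
    · simp only [Sum.elim_inl, Set.image_image]
      rw [Set.image_preimage_eq_inter_range, hp,
        Set.inter_eq_left.2 (Set.subset_iUnion (fun i => (a i : Set M)) i)]
  · exact corresponds_singleton (x := Sum.elim p z) (y := Sum.elim p z') (Sum.inr i)

/-- Sets definable in `M` over finitely many parameters are definable in `W(M)` over the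
corresponding atoms. -/
theorem weakMonadic_definable_of_definable {M : Type w} [L.Structure M] {P : Set M}
    (hP : P.Finite) {n : ℕ} {S : Set (Fin n → M)} (hS : P.Definable L S) :
    {A : Finset M | ∃ x : M, A = {x}}.Definable L.weakMonadic (atomTuple '' S) := by
  obtain ⟨φ, hφ⟩ := Set.definable_iff_exists_formula_sum.1 hS
  have := hP.to_subtype
  obtain ⟨k, ⟨e⟩⟩ := Finite.exists_equiv_fin (P ⊕ Fin n)
  rw [Set.definable_iff_exists_formula_sum]
  -- Turning the parameters into variables makes `φ` a basic relation of `W(M)`, with the atoms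
  -- `{p}` as arguments.
  let R : L.weakMonadic.Relations k := WeakMonadicRel.definable (φ.relabel e)
  let c : P → {A : Finset M | ∃ x : M, A = {x}} := fun p => ⟨{p.1}, p.1, rfl⟩
  refine ⟨R.formula fun j => Term.var (Sum.map c id (e.symm j)), ?_⟩
  ext A
  simp only [Set.mem_ofPred_eq, Formula.realize_rel, Term.realize_var]
  constructor
  · rintro ⟨z, hz, rfl⟩
    rw [hφ] at hz
    refine ⟨Sum.elim (↑) z ∘ e.symm, ?_, ?_⟩
    · simpa [Function.comp_assoc] using hz
    · funext j
      rcases h : e.symm j with p | i <;> simp [atomTuple, h, c]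
  · rintro ⟨y, hy, hyA⟩
    have hval : ∀ q, ({y (e q)} : Finset M) = Sum.elim (↑) A (Sum.map c id q) := fun q => by
      simpa [atomTuple] using congrFun hyA (e q)
    refine ⟨fun i => y (e (Sum.inr i)), ?_, funext fun i => hval (Sum.inr i)⟩
    rw [hφ]
    have hy' : φ.Realize (y ∘ e) := by simpa using hy
    have hye : y ∘ e = Sum.elim (↑) (fun i => y (e (Sum.inr i))) := by
      funext q
      rcases q with p | i
      · exact Finset.singleton_injective (hval (Sum.inl p))
      · rfl
    rwa [hye] at hy'

theorem definable₁_atoms (M : Type w) [L.Structure M] :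
    (∅ : Set (Finset M)).Definable₁ L.weakMonadic {A : Finset M | ∃ x : M, A = {x}} := by
  refine Set.empty_definable_iff.2 ⟨Relations.formula (L := L.weakMonadic) (n := 1)
    (WeakMonadicRel.definable ⊤) fun i => Term.var i, ?_⟩
  ext A
  constructor
  · rintro ⟨x, hx⟩
    exact ⟨fun _ => x, by simp, funext fun i => by
      rw [Subsingleton.elim i 0]
      exact hx.symm⟩
  · rintro ⟨z, -, hz⟩
    exact ⟨z 0, (congrFun hz 0).symm⟩

theorem HasFinitelyManyTypes.stablyEmbedded_atoms {M : Type w} [L.Structure M]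
    (hM : HasFinitelyManyTypes L M) :
    L.weakMonadic.StablyEmbedded {A : Finset M | ∃ x : M, A = {x}} := by
  refine ⟨definable₁_atoms M, fun n S hS hdef => ?_⟩
  -- A definition uses finitely many parameters. These are traded for finitely many elements of `M`
  -- by descending to `M`, and the resulting definition is read back in `W(M)` over atoms.
  obtain ⟨A₀, -, hA₀⟩ := Set.definable_iff_finitely_definable.1 hdef
  obtain ⟨k, a, ha⟩ := exists_fin_range_eq A₀.finite_toSet
  have himage : S = atomTuple '' (atomTuple ⁻¹' S) := by
    refine (Set.image_preimage_eq_of_subset fun A hA => ?_).symm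
    choose x hx using hS A hA
    exact ⟨x, funext fun i => (hx i).symm⟩
  rw [← ha, himage] at hA₀
  rw [himage]
  exact weakMonadic_definable_of_definable (Set.finite_iUnion fun i => (a i).finite_toSet)
    (hM.definable_of_weakMonadic_definable hA₀)

end FirstOrder.Language

theorem proposition2p5 {L : FirstOrder.Language.{u, v}} [Countable L.Symbols]
    (T : L.Theory) (hT : (ℵ₀ : Cardinal.{w}).Categorical T) :
    -- (i) if `M ≺ N` then `W(M) ≺ W(N)`
    (∀ (M : Type w₁) (N : Type w₂) [L.Structure M] [L.Structure N], M ⊨ T → N ⊨ T →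
      ∀ f : M ↪ₑ[L] N, ∃ g : Finset M ↪ₑ[L.weakMonadic] Finset N,
        ∀ A : Finset M, (g A : Set N) = f '' (A : Set M)) ∧
    -- (ii) `M` is stably embedded in `W(M)`, with control of the parameters
    (∀ (M : Type w₁) [L.Structure M], M ⊨ T →
      L.weakMonadic.StablyEmbedded {A : Finset M | ∃ x : M, A = {x}} ∧
      ∀ (n k : ℕ) (S : Set (Fin n → M)) (a : Fin k → Finset M),
        (Set.range a).Definable L.weakMonadic (FirstOrder.Language.atomTuple '' S) →
          (⋃ i, (a i : Set M)).Definable L S) :=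
  ⟨fun M _ _ _ hM _ f => FirstOrder.Language.exists_weakMonadic_elementaryEmbedding
      (FirstOrder.Language.hasFinitelyManyTypes_of_categorical hT M hM) f,
    fun M _ hM =>
      have h := FirstOrder.Language.hasFinitelyManyTypes_of_categorical hT M hM
      ⟨h.stablyEmbedded_atoms, fun _ _ _ _ hS => h.definable_of_weakMonadic_definable hS⟩⟩
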